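/- Let $\mathcal R$ be an expansion of the real field $\bar{\mathbb R}$, i.e. a first-order structure with underlying set $\mathbb R$ in a language containing symbols for the field operations of $\mathbb R$, interpreted as usual. If $U\subseteq\mathbb R^n$ is open, a function $f:U\to\mathbb R$ is called locally definable in $\mathcal R$ (with parameters from $A\subseteq\mathbb R$; without parameters if $A=\emptyset$) if every $a\in U$ has a neighbourhood $U_a\subseteq U$ such that the graph of $f|_{U_a}$ is definable in $\mathcal R$ (with parameters from $A$). A complex-valued function on an open subset of $\mathbb C=\mathbb R^2$ is locally definable if its real and imaginary parts are. For a lattice $\Lambda=\mathbb Z\omega_1+\mathbb Z\omega_2\subset\mathbb C$, with $\omega_1,\omega_2$ linearly independent over $\mathbb R$, let \[\wp_\Lambda(z)=\frac1{z^2}+\sum_{\lambda\in\Lambda\setminus\{0\}}\left(\frac1{(z-\lambda)^2}-\frac1{\lambda^2}\right),\] regarded as a holomorphic function on $\mathbb C\setminus\Lambda$. A lattice $\Lambda_1$ is isogenous to a lattice $\Lambda_2$ if $\Lambda_1\subseteq\alpha\Lambda_2$ for some $\alpha\in\mathbb C\setminus\{0\}$. One says that $\wp_{\Lambda'}$ is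 obtained from $\wp_\Lambda$ by isogeny and Schwarz reflection if $\Lambda$ is isogenous to $\Lambda'$ or to the complex conjugate lattice $\overline{\Lambda'}$. Let $\Lambda,\Lambda'$ be lattices in $\mathbb C$ such that $\wp_{\Lambda'}$ is obtained from $\wp_\Lambda$ by isogeny and Schwarz reflection. If $\wp_\Lambda$ is locally definable in $\mathcal R$, without parameters or with parameters from some set $A\subseteq\mathbb R$, then $\wp_{\Lambda'}$ is locally definable in $\mathcal R$ with parameters from $\mathbb R$. -/

import Mathlib

open Set Topology

universe u v

/-- An expansion of the real field: a first-order structure on `ℝ`, in some language `L`, among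
whose basic symbols there are ones interpreted as the field operations `+, *, -, 0, 1` of `ℝ`
(the order is then definable). -/
def IsExpansionOfRealField (L : FirstOrder.Language.{u, v}) [L.Structure ℝ] : Prop :=
  letI := FirstOrder.Ring.compatibleRingOfRing ℝ
  ∃ φ : FirstOrder.Language.ring.LHom L, φ.IsExpansionOn ℝ

/-- The graph of the restriction `f|V`, for `V ⊆ ℝⁿ`, as a subset of `ℝⁿ⁺¹`. -/
def graphOn {n : ℕ} (f : (Fin n → ℝ) → ℝ) (V : Set (Fin n → ℝ)) : Set (Fin (n + 1) → ℝ) :=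
  {x | Fin.init x ∈ V ∧ x (Fin.last n) = f (Fin.init x)}

/-- The restriction of `f` to the (open) set `U ⊆ ℝⁿ` is locally definable in the `L`-structure
`ℝ`, with parameters from `A`: every point `a` of `U` has a neighbourhood `V ⊆ U` such that
`f|V` is definable with parameters from `A`. -/
def LocallyDefinable (L : FirstOrder.Language.{u, v}) [L.Structure ℝ] (A : Set ℝ) {n : ℕ}
    (U : Set (Fin n → ℝ)) (f : (Fin n → ℝ) → ℝ) : Prop :=
  ∀ a ∈ U, ∃ V ∈ 𝓝 a, V ⊆ U ∧ A.Definable L (graphOn f V)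

/-- The identification of `ℝ²` with `ℂ`. -/
def toComplex (x : Fin 2 → ℝ) : ℂ := ⟨x 0, x 1⟩

/-- A complex function `f` on the (open) set `U ⊆ ℂ` is locally definable if its real and
imaginary parts are, as real functions on an open subset of `ℝ²`. -/
def LocallyDefinableComplex (L : FirstOrder.Language.{u, v}) [L.Structure ℝ] (A : Set ℝ)
    (U : Set ℂ) (f : ℂ → ℂ) : Prop :=
  LocallyDefinable L A (toComplex ⁻¹' U) (fun x => (f (toComplex x)).re) ∧
    LocallyDefinable L A (toComplex ⁻¹' U) (fun x => (f (toComplex x)).im)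

/-- `℘_Λ` is locally definable, as a holomorphic function on `ℂ ∖ Λ`, where `Λ` is the lattice
spanned by the pair of periods `P`. -/
def WeierstrassPLocallyDefinable (L : FirstOrder.Language.{u, v}) [L.Structure ℝ] (A : Set ℝ)
    (P : PeriodPair) : Prop :=
  LocallyDefinableComplex L A ((P.lattice : Set ℂ)ᶜ) P.weierstrassP

/-- The pair of complex conjugate periods; it spans the complex conjugate lattice. -/
noncomputable def conjPeriodPair (P : PeriodPair) : PeriodPair where
  ω₁ := (starRingEnd ℂ) P.ω₁
  ω₂ := (starRingEnd ℂ) P.ω₂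
  indep := by
    rw [LinearIndependent.pair_iff]
    intro s t h
    refine LinearIndependent.pair_iff.mp P.indep s t ?_
    have h' := congrArg (starRingEnd ℂ) h
    simpa [Complex.real_smul] using h'

/-- Isogeny of lattices: `Λ₁ ⊆ α Λ₂` for some nonzero complex number `α`. -/
def IsogenousLattices (P₁ P₂ : PeriodPair) : Prop :=
  ∃ α : ℂ, α ≠ 0 ∧ ∀ l ∈ P₁.lattice, ∃ m ∈ P₂.lattice, l = α * m

/-- ISR-equivalence (isogeny and Schwarz reflection) of the Weierstrass functions of two lattices:
`Λ₁` is isogenous to `Λ₂` or to the complex conjugate of `Λ₂`. -/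
def ISREquivalent (P₁ P₂ : PeriodPair) : Prop :=
  IsogenousLattices P₁ P₂ ∨ IsogenousLattices P₁ (conjPeriodPair P₂)

/-! If `Λ ⊆ αΛ'`, then `α⁻¹Λ` has finite index in `Λ'`, since both have rank 2. Splitting the series
of `℘_{Λ'}` over the cosets `r_q + α⁻¹Λ` gives `℘_{Λ'}(z) = ∑_q α²(℘_Λ(αz - αr_q) - ℘_Λ(-αr_q))`,
which is `exists_weierstrassP_eq_sum`. Local definability survives affine changes of variable and
finite sums (`LocallyDefinableComplex.precomp`, `postcomp`, `sum`); real parameters are allowed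
because `α`, the `r_q` and the constant terms enter as such. Complex conjugation is definable and
carries `℘_Λ` to the function of the conjugate lattice, which settles Schwarz reflection. -/

open FirstOrder Set Function

/-! ### Definable real functions and closure properties of local definability. -/

section Definability

variable {L : FirstOrder.Language.{u, v}} [L.Structure ℝ] {A : Set ℝ} {β : Type*}

/-- Addition and multiplication of definable real functions are definable. -/
theorem IsExpansionOfRealField.definableFun_add (hL : IsExpansionOfRealField L)
    {f g : (β → ℝ) → ℝ} (hf : A.DefinableFun L f) (hg : A.DefinableFun L g) :
    A.DefinableFun L fun x => f x + g x := by
  let _ := FirstOrder.Ring.compatibleRingOfRing ℝ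
  obtain ⟨φ, hφ⟩ := hL
  have h : A.DefinableFun L fun y : Fin 2 → ℝ => y 0 + y 1 := by
    refine .of_empty ?_
    have h := Set.Definable.map_expansion
      (Language.Term.definableFun_realize (M := ℝ)
        (.var 0 + .var 1 : Language.ring.Term (Fin 2))) φ
    simpa [DefinableFun] using h
  refine DefinableFun.comp (g := fun x => ![f x, g x]) ?_ h
  simp [DefinableMap, *]

theorem IsExpansionOfRealField.definableFun_mul (hL : IsExpansionOfRealField L)
    {f g : (β → ℝ) → ℝ} (hf : A.DefinableFun L f) (hg : A.DefinableFun L g) :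
    A.DefinableFun L fun x => f x * g x := by
  let _ := FirstOrder.Ring.compatibleRingOfRing ℝ
  obtain ⟨φ, hφ⟩ := hL
  have h : A.DefinableFun L fun y : Fin 2 → ℝ => y 0 * y 1 := by
    refine .of_empty ?_
    have h := Set.Definable.map_expansion
      (Language.Term.definableFun_realize (M := ℝ)
        (.var 0 * .var 1 : Language.ring.Term (Fin 2))) φ
    simpa [DefinableFun] using h
  refine DefinableFun.comp (g := fun x => ![f x, g x]) ?_ h
  simp [DefinableMap, *]

theorem definableFun_const_univ (c : ℝ) : (univ : Set ℝ).DefinableFun L fun _ : β → ℝ => c :=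
  L.definableFun_const β (mem_univ c)

theorem IsExpansionOfRealField.definableFun_neg (hL : IsExpansionOfRealField L)
    {f : (β → ℝ) → ℝ} (hf : (univ : Set ℝ).DefinableFun L f) :
    (univ : Set ℝ).DefinableFun L fun x => -f x := by
  simpa using hL.definableFun_mul (definableFun_const_univ (-1)) hf

theorem IsExpansionOfRealField.definableFun_sub (hL : IsExpansionOfRealField L)
    {f g : (β → ℝ) → ℝ} (hf : (univ : Set ℝ).DefinableFun L f)
    (hg : (univ : Set ℝ).DefinableFun L g) :
    (univ : Set ℝ).DefinableFun L fun x => f x - g x := by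
  simpa [sub_eq_add_neg] using hL.definableFun_add hf (hL.definableFun_neg hg)

theorem IsExpansionOfRealField.definableFun_sum (hL : IsExpansionOfRealField L) {ι : Type*}
    (s : Finset ι) {f : ι → (β → ℝ) → ℝ} (hf : ∀ i, (univ : Set ℝ).DefinableFun L (f i)) :
    (univ : Set ℝ).DefinableFun L fun x => ∑ i ∈ s, f i x := by
  classical
  induction s using Finset.induction_on with
  | empty => simpa using definableFun_const_univ 0
  | insert i s hi ih => simpa [Finset.sum_insert hi] using hL.definableFun_add (hf i) ih

/-- The order comes from the field: a real is positive iff it is a nonzero square. -/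
theorem IsExpansionOfRealField.definable_pos (hL : IsExpansionOfRealField L)
    {f : (β → ℝ) → ℝ} (hf : (univ : Set ℝ).DefinableFun L f) :
    (univ : Set ℝ).Definable L {x | 0 < f x} := by
  have hf' : (univ : Set ℝ).DefinableFun L fun w : β ⊕ Unit → ℝ => f (w ∘ Sum.inl) := by
    simpa [DefinableFun, tupleGraph, Function.comp_def] using!
      Set.Definable.preimage_comp (fun | none => none | some i => some (Sum.inl i)) hf
  have hu : (univ : Set ℝ).DefinableFun L fun w : β ⊕ Unit → ℝ => w (Sum.inr ()) :=
    DefinableFun.proj L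
  have h := Set.Definable.exists_of_finite
    ((hf'.ofPred_eq (hL.definableFun_mul hu hu)).inter
      (hf'.ofPred_eq_const (mem_univ 0)).compl)
  convert h using 1
  ext x
  constructor
  · intro hx
    exact ⟨fun _ => √(f x), (Real.mul_self_sqrt (le_of_lt hx)).symm, hx.ne'⟩
  · rintro ⟨u, h₁, h₂⟩
    have h₁ : f x = u () * u () := h₁
    have h₂ : f x ≠ 0 := h₂
    exact lt_of_le_of_ne (h₁ ▸ mul_self_nonneg _) h₂.symm

/-- The points of `ℝⁿ` have arbitrarily small definable neighbourhoods. -/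
theorem IsExpansionOfRealField.exists_definable_nhds (hL : IsExpansionOfRealField L) {n : ℕ}
    {a : Fin n → ℝ} {U : Set (Fin n → ℝ)} (hU : U ∈ 𝓝 a) :
    ∃ V ∈ 𝓝 a, V ⊆ U ∧ (univ : Set ℝ).Definable L V := by
  obtain ⟨r, hr, hrU⟩ := Metric.mem_nhds_iff.mp hU
  refine ⟨Metric.ball a r, Metric.ball_mem_nhds a hr, hrU, ?_⟩
  have h : Metric.ball a r = ⋂ i, {x : Fin n → ℝ | 0 < r * r - (x i - a i) * (x i - a i)} := by
    ext x
    simp only [Metric.mem_ball, dist_pi_lt_iff hr, mem_iInter, mem_ofPred_eq, sub_pos, Real.dist_eq]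
    refine forall_congr' fun i => ?_
    rw [← sq, ← sq, sq_lt_sq, abs_of_pos hr]
  rw [h]
  refine definable_iInter_of_finite fun i => hL.definable_pos ?_
  have hx : (univ : Set ℝ).DefinableFun L fun x : Fin n → ℝ => x i - a i :=
    hL.definableFun_sub (DefinableFun.proj L) (definableFun_const_univ _)
  exact hL.definableFun_sub (definableFun_const_univ _) (hL.definableFun_mul hx hx)

theorem graphOn_inter {n : ℕ} (f : (Fin n → ℝ) → ℝ) (V W : Set (Fin n → ℝ)) :
    _root_.graphOn f (V ∩ W) = _root_.graphOn f V ∩ Fin.init ⁻¹' W := by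
  ext x
  simp only [_root_.graphOn, mem_inter_iff, mem_ofPred_eq, mem_preimage]
  tauto

theorem Set.Definable.preimage_init {n : ℕ} {W : Set (Fin n → ℝ)} (hW : A.Definable L W) :
    A.Definable L ((Fin.init : (Fin (n + 1) → ℝ) → Fin n → ℝ) ⁻¹' W) :=
  hW.preimage_comp Fin.castSucc

theorem LocallyDefinable.mono_parameters {B : Set ℝ} {n : ℕ} {U : Set (Fin n → ℝ)}
    {f : (Fin n → ℝ) → ℝ} (hf : LocallyDefinable L A U f) (hAB : A ⊆ B) :
    LocallyDefinable L B U f := fun a ha =>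
  let ⟨V, hV, hVU, h⟩ := hf a ha
  ⟨V, hV, hVU, h.mono hAB⟩

theorem LocallyDefinable.congr {n : ℕ} {U : Set (Fin n → ℝ)} {f g : (Fin n → ℝ) → ℝ}
    (hf : LocallyDefinable L A U f) (h : ∀ x, f x = g x) : LocallyDefinable L A U g :=
  funext h ▸ hf

/-- The values `f i x` are named by existentially quantified variables `u i`, constrained by the
graphs of the `f i`. -/
theorem LocallyDefinable.comp_definableFun (hL : IsExpansionOfRealField L) {n : ℕ} {ι : Type*}
    [Finite ι] {U : Set (Fin n → ℝ)} (hU : IsOpen U) {f : ι → (Fin n → ℝ) → ℝ}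
    (hf : ∀ i, LocallyDefinable L univ U (f i)) {F : (ι → ℝ) → ℝ}
    (hF : (univ : Set ℝ).DefinableFun L F) :
    LocallyDefinable L univ U fun x => F fun i => f i x := by
  intro a ha
  -- `W` keeps the neighbourhood inside `U` even when `ι` is empty and the intersection of the `V i`
  -- is everything.
  obtain ⟨W, hW, hWU, hWdef⟩ := hL.exists_definable_nhds (hU.mem_nhds ha)
  choose V hV hVU hVdef using fun i => hf i a ha
  refine ⟨(⋂ i, V i) ∩ W, Filter.inter_mem (Filter.iInter_mem.mpr hV) hW,
    inter_subset_right.trans hWU, ?_⟩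
  rw [graphOn_inter]
  refine Set.Definable.inter ?_ hWdef.preimage_init
  have h₁ : (univ : Set ℝ).Definable L
      (⋂ i, {w : Fin (n + 1) ⊕ ι → ℝ | (Fin.snoc (fun j => w (Sum.inl (Fin.castSucc j)))
        (w (Sum.inr i)) : Fin (n + 1) → ℝ) ∈ _root_.graphOn (f i) (V i)}) := by
    refine definable_iInter_of_finite fun i => ?_
    refine (congrArg _ ?_).mp ((hVdef i).preimage_comp
      (Fin.lastCases (Sum.inr i) fun j => Sum.inl (Fin.castSucc j) :
        Fin (n + 1) → Fin (n + 1) ⊕ ι))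
    ext w
    simp [_root_.graphOn, Fin.init_def]
  have hF' : (univ : Set ℝ).DefinableFun L fun w : Fin (n + 1) ⊕ ι → ℝ => F (w ∘ Sum.inr) := by
    simpa [DefinableFun, tupleGraph, Function.comp_def] using!
      Set.Definable.preimage_comp (fun | none => none | some i => some (Sum.inr i)) hF
  have h₂ : (univ : Set ℝ).Definable L
      {w : Fin (n + 1) ⊕ ι → ℝ | w (Sum.inl (Fin.last n)) = F (w ∘ Sum.inr)} :=
    (DefinableFun.proj L).ofPred_eq hF'
  convert (h₁.inter h₂).exists_of_finite using 1
  ext x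
  simp only [_root_.graphOn, mem_iInter, mem_ofPred_eq, mem_inter_iff, Fin.init_snoc, Fin.snoc_last,
    Sum.elim_inl, Sum.elim_inr, Sum.elim_comp_inr]
  constructor
  · rintro ⟨hx, hx'⟩
    exact ⟨fun i => f i (Fin.init x), fun i => ⟨hx i, rfl⟩, hx'⟩
  · rintro ⟨u, hu, hx⟩
    refine ⟨fun i => (hu i).1, hx.trans (congrArg F (funext fun i => (hu i).2))⟩

/-- The new graph is the preimage of the old one under `(x, y) ↦ (T x, y)`, cut down to a definable
neighbourhood because `T ⁻¹' V` may leave `U'`. -/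
theorem LocallyDefinable.precomp (hL : IsExpansionOfRealField L) {m n : ℕ}
    {U : Set (Fin n → ℝ)} {U' : Set (Fin m → ℝ)} (hU' : IsOpen U') {f : (Fin n → ℝ) → ℝ}
    (hf : LocallyDefinable L univ U f) {T : (Fin m → ℝ) → Fin n → ℝ}
    (hT : (univ : Set ℝ).DefinableMap L T) (hTc : Continuous T) (hTU : MapsTo T U' U) :
    LocallyDefinable L univ U' fun x => f (T x) := by
  intro a ha
  obtain ⟨W, hW, hWU, hWdef⟩ := hL.exists_definable_nhds (hU'.mem_nhds ha)
  obtain ⟨V, hV, hVU, hVdef⟩ := hf (T a) (hTU ha)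
  refine ⟨T ⁻¹' V ∩ W, Filter.inter_mem (hTc.continuousAt.preimage_mem_nhds hV) hW,
    inter_subset_right.trans hWU, ?_⟩
  rw [graphOn_inter]
  refine Set.Definable.inter ?_ hWdef.preimage_init
  have hS : (univ : Set ℝ).DefinableMap L
      fun x : Fin (m + 1) → ℝ => (Fin.snoc (T (Fin.init x)) (x (Fin.last m)) : Fin (n + 1) → ℝ) := by
    intro i
    induction i using Fin.lastCases with
    | last => simpa using DefinableFun.proj L
    | cast j =>
      simpa [DefinableFun, tupleGraph, Function.comp_def, Fin.init_def] using!
        Set.Definable.preimage_comp (fun | none => none | some i => some (Fin.castSucc i)) (hT j)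
  convert hVdef.preimage_map hS using 1
  ext x
  simp [_root_.graphOn]

end Definability

/-! ### Transfer to complex functions through real and imaginary parts. -/

section ComplexFunctions

variable {L : FirstOrder.Language.{u, v}} [L.Structure ℝ]

/-- The function `T : ℂ → ℂ` is definable with real parameters. -/
def DefinableComplexFun (L : FirstOrder.Language.{u, v}) [L.Structure ℝ] (T : ℂ → ℂ) : Prop :=
  (univ : Set ℝ).DefinableFun L (fun x : Fin 2 → ℝ => (T (toComplex x)).re) ∧
    (univ : Set ℝ).DefinableFun L (fun x : Fin 2 → ℝ => (T (toComplex x)).im)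

theorem continuous_toComplex : Continuous toComplex := by
  have h := Complex.equivRealProdCLM.symm.continuous.comp
    ((continuous_apply (A := fun _ => ℝ) (0 : Fin 2)).prodMk
      (continuous_apply (A := fun _ => ℝ) (1 : Fin 2)))
  refine h.congr fun x => ?_
  apply Complex.ext <;> simp [toComplex]

theorem IsExpansionOfRealField.definableComplexFun_affine (hL : IsExpansionOfRealField L)
    (a b : ℂ) : DefinableComplexFun L fun z => a * z + b := by
  have h (i : Fin 2) (c : ℝ) : (univ : Set ℝ).DefinableFun L fun x : Fin 2 → ℝ => c * x i :=
    hL.definableFun_mul (definableFun_const_univ c) (DefinableFun.proj L)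
  constructor
  · simpa [toComplex] using hL.definableFun_add (hL.definableFun_sub (h 0 a.re) (h 1 a.im))
      (definableFun_const_univ b.re)
  · simpa [toComplex] using hL.definableFun_add (hL.definableFun_add (h 1 a.re) (h 0 a.im))
      (definableFun_const_univ b.im)

theorem IsExpansionOfRealField.definableComplexFun_conj (hL : IsExpansionOfRealField L) :
    DefinableComplexFun L (starRingEnd ℂ) :=
  ⟨by simpa [toComplex] using DefinableFun.proj L,
    by simpa [toComplex] using hL.definableFun_neg (DefinableFun.proj L)⟩

theorem LocallyDefinableComplex.postcomp (hL : IsExpansionOfRealField L) {U : Set ℂ}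
    (hU : IsOpen U) {f T : ℂ → ℂ} (hf : LocallyDefinableComplex L univ U f)
    (hT : DefinableComplexFun L T) : LocallyDefinableComplex L univ U fun z => T (f z) := by
  have h : ∀ i : Fin 2, LocallyDefinable L univ (toComplex ⁻¹' U)
      (![fun x => (f (toComplex x)).re, fun x => (f (toComplex x)).im] i) :=
    Fin.forall_fin_two.mpr hf
  exact ⟨LocallyDefinable.comp_definableFun hL (hU.preimage continuous_toComplex) h hT.1,
    LocallyDefinable.comp_definableFun hL (hU.preimage continuous_toComplex) h hT.2⟩

theorem LocallyDefinableComplex.precomp (hL : IsExpansionOfRealField L) {U U' : Set ℂ}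
    (hU' : IsOpen U') {f T : ℂ → ℂ} (hf : LocallyDefinableComplex L univ U f)
    (hT : DefinableComplexFun L T) (hTc : Continuous T) (hTU : MapsTo T U' U) :
    LocallyDefinableComplex L univ U' fun z => f (T z) := by
  have hS : (univ : Set ℝ).DefinableMap L
      fun x : Fin 2 → ℝ => ![(T (toComplex x)).re, (T (toComplex x)).im] :=
    Fin.forall_fin_two.mpr hT
  have hSc : Continuous fun x : Fin 2 → ℝ => ![(T (toComplex x)).re, (T (toComplex x)).im] := by
    have := hTc.comp continuous_toComplex
    refine continuous_pi (Fin.forall_fin_two.mpr ⟨?_, ?_⟩)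
    · exact Complex.continuous_re.comp this
    · exact Complex.continuous_im.comp this
  have hU'' := hU'.preimage continuous_toComplex
  exact ⟨hf.1.precomp hL hU'' hS hSc fun x hx => hTU hx,
    hf.2.precomp hL hU'' hS hSc fun x hx => hTU hx⟩

theorem LocallyDefinableComplex.sum (hL : IsExpansionOfRealField L) {ι : Type*} [Fintype ι]
    {U : Set ℂ} (hU : IsOpen U) {f : ι → ℂ → ℂ}
    (hf : ∀ i, LocallyDefinableComplex L univ U (f i)) :
    LocallyDefinableComplex L univ U fun z => ∑ i, f i z := by
  have hsum : (univ : Set ℝ).DefinableFun L fun y : ι → ℝ => ∑ i, y i :=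
    hL.definableFun_sum _ fun i => DefinableFun.proj L
  have hU' := hU.preimage continuous_toComplex
  exact ⟨(LocallyDefinable.comp_definableFun hL hU' (fun i => (hf i).1) hsum).congr
      fun x => (Complex.re_sum _ _).symm,
    (LocallyDefinable.comp_definableFun hL hU' (fun i => (hf i).2) hsum).congr
      fun x => (Complex.im_sum _ _).symm⟩

end ComplexFunctions

/-! ### Identities between Weierstrass functions of related lattices. -/

section Lattices

theorem mem_lattice_conjPeriodPair {P : PeriodPair} {z : ℂ} :
    z ∈ (conjPeriodPair P).lattice ↔ (starRingEnd ℂ) z ∈ P.lattice := by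
  simp only [PeriodPair.mem_lattice, conjPeriodPair]
  refine exists₂_congr fun m n => ?_
  rw [← (starRingEnd ℂ).injective.eq_iff]
  simp

theorem weierstrassP_conjPeriodPair (P : PeriodPair) (z : ℂ) :
    (conjPeriodPair P).weierstrassP ((starRingEnd ℂ) z) = (starRingEnd ℂ) (P.weierstrassP z) := by
  let e : P.lattice ≃ (conjPeriodPair P).lattice :=
    { toFun := fun l => ⟨(starRingEnd ℂ) l, mem_lattice_conjPeriodPair.mpr (by simp)⟩
      invFun := fun l => ⟨(starRingEnd ℂ) l, mem_lattice_conjPeriodPair.mp l.2⟩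
      left_inv := fun l => by simp
      right_inv := fun l => by simp }
  have h₁ := (e.hasSum_iff.mpr
    ((conjPeriodPair P).hasSum_weierstrassP ((starRingEnd ℂ) z)))
  have h₂ := (P.hasSum_weierstrassP z).map (starRingEnd ℂ) Complex.continuous_conj
  refine h₁.unique (h₂.congr_fun fun l => ?_)
  simp [e]

/-- If `Λ ⊆ αΛ'` then `℘_{Λ'}` is a finite sum of translates of `z ↦ ℘_Λ (α z)`, up to affine
transformations. -/
theorem exists_weierstrassP_eq_sum {P P' : PeriodPair} {α : ℂ} (hα : α ≠ 0)
    (h : ∀ l ∈ P.lattice, ∃ m ∈ P'.lattice, l = α * m) :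
    ∃ (Q : Type) (_ : Fintype Q) (r : Q → P'.lattice), ∀ z, P'.weierstrassP z =
      ∑ q, (α ^ 2 * P.weierstrassP (α * z + -(α * r q)) +
        -(α ^ 2 * P.weierstrassP (-(α * r q)))) := by
  choose! φ hφ hφ' using h
  have hmem {l : ℂ} (hl : l ∈ P.lattice) : α⁻¹ * l ∈ P'.lattice := by
    have h := hφ l hl
    rwa [hφ' l hl, inv_mul_cancel_left₀ hα]
  let i : P.lattice →ₗ[ℤ] P'.lattice :=
    { toFun := fun l => ⟨α⁻¹ * l, hmem l.2⟩
      map_add' := fun x y => Subtype.ext (by simp [mul_add])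
      map_smul' := fun n x => Subtype.ext (by simp [mul_left_comm]) }
  have hi : Injective i := fun x y hxy =>
    Subtype.ext (mul_left_cancel₀ (inv_ne_zero hα) (congrArg Subtype.val hxy))
  have : Module.Free ℤ P'.lattice := .of_basis P'.latticeBasis
  have : Module.Finite ℤ P'.lattice := .of_basis P'.latticeBasis
  have : Finite (P'.lattice ⧸ LinearMap.range i) := by
    refine Submodule.finiteQuotientOfFreeOfRankEq _ ?_
    rw [LinearMap.finrank_range_of_inj hi, P.finrank_lattice, P'.finrank_lattice]
  have : Fintype (P'.lattice ⧸ LinearMap.range i) := .ofFinite _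
  let r : (P'.lattice ⧸ LinearMap.range i) → P'.lattice := Quotient.out
  have hr (q) : Submodule.Quotient.mk (r q) = q := Quotient.out_eq _
  -- `Λ'` is the disjoint union of the cosets `r_q + α⁻¹Λ`.
  have hbij : Bijective fun x : (P'.lattice ⧸ LinearMap.range i) × P.lattice => r x.1 + i x.2 := by
    have hmk (x : (P'.lattice ⧸ LinearMap.range i) × P.lattice) :
        (Submodule.Quotient.mk (r x.1 + i x.2) : P'.lattice ⧸ LinearMap.range i) = x.1 := by
      conv_rhs => rw [← hr x.1]
      rw [Submodule.Quotient.eq]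
      simp
    refine ⟨fun x y hxy => ?_, fun m => ?_⟩
    · have h₁ : x.1 = y.1 := by rw [← hmk x, ← hmk y]; exact congrArg _ hxy
      refine Prod.ext h₁ (hi ?_)
      simpa [h₁] using hxy
    · obtain ⟨l, hl⟩ : m - r (Submodule.Quotient.mk m) ∈ LinearMap.range i := by
        rw [← Submodule.Quotient.eq, hr]
      exact ⟨⟨Submodule.Quotient.mk m, l⟩, by simp [hl]⟩
  refine ⟨_, this, r, fun z => ?_⟩
  have h₁ := (Equiv.ofBijective _ hbij).hasSum_iff.mpr (P'.hasSum_weierstrassP z)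
  refine (h₁.prod_fiberwise fun q => ?_).unique (hasSum_fintype _)
  -- In the difference the terms `1 / l ^ 2` cancel; the second series supplies the correction terms
  -- of `℘_{Λ'}`.
  have h₂ := ((P.hasSum_weierstrassP (α * z + -(α * r q))).mul_left (α ^ 2)).add
    ((P.hasSum_weierstrassP (-(α * r q))).mul_left (α ^ 2)).neg
  refine h₂.congr_fun fun l => ?_
  -- This also holds at a pole, both sides being `0` there since `1 / 0 = 0`; hence the identity
  -- needs no exception for lattice points, nor for the trivial coset.
  have key (w : ℂ) : 1 / (w - α⁻¹ * l) ^ 2 = α ^ 2 * (1 / (α * w - l) ^ 2) := by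
    have : α * w - l = α * (w - α⁻¹ * l) := by rw [mul_sub, mul_inv_cancel_left₀ hα]
    rw [this, mul_pow, one_div, one_div, mul_inv, mul_inv_cancel_left₀ (pow_ne_zero 2 hα)]
  have k₁ := key (z - r q)
  have k₂ := key (-r q)
  have e₁ : (z - (r q + α⁻¹ * l) : ℂ) = z - r q - α⁻¹ * l := by ring
  have e₂ : ((r q + α⁻¹ * l) ^ 2 : ℂ) = (-r q - α⁻¹ * l) ^ 2 := by ring
  have e₃ : (α * z + -(α * r q) - l : ℂ) = α * (z - r q) - l := by ring
  have e₄ : (-(α * r q) - l : ℂ) = α * (-r q) - l := by ring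
  simp only [Function.comp_apply, Equiv.ofBijective_apply, Submodule.coe_add, i,
    LinearMap.coe_mk, AddHom.coe_mk]
  rw [e₁, e₂, e₃, e₄, k₁, k₂]
  ring

end Lattices

/-! ### Local definability under isogeny and conjugation. -/

section WeierstrassP

variable {L : FirstOrder.Language.{u, v}} [L.Structure ℝ] {P P' : PeriodPair}

theorem WeierstrassPLocallyDefinable.of_isogenous (hL : IsExpansionOfRealField L)
    (hP : WeierstrassPLocallyDefinable L univ P) (h : IsogenousLattices P P') :
    WeierstrassPLocallyDefinable L univ P' := by
  obtain ⟨α, hα, h⟩ := h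
  obtain ⟨Q, _, r, hr⟩ := exists_weierstrassP_eq_sum hα h
  have hU : IsOpen ((P'.lattice : Set ℂ)ᶜ) := P'.isClosed_lattice.isOpen_compl
  rw [WeierstrassPLocallyDefinable, funext hr]
  refine LocallyDefinableComplex.sum hL hU fun q => ?_
  refine LocallyDefinableComplex.postcomp hL hU
    (LocallyDefinableComplex.precomp hL hU hP
      (hL.definableComplexFun_affine α (-(α * r q))) (by fun_prop) fun z hz hz' => hz ?_)
    (hL.definableComplexFun_affine (α ^ 2) (-(α ^ 2 * P.weierstrassP (-(α * r q)))))
  -- No summand meets a pole off `Λ'`: from `αz - αr_q ∈ Λ ⊆ αΛ'` it follows that `z ∈ Λ'`.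
  obtain ⟨m, hm, hzm⟩ := h _ hz'
  have : z = m + r q := mul_left_cancel₀ hα (by linear_combination hzm)
  exact this ▸ add_mem hm (r q).2

theorem WeierstrassPLocallyDefinable.of_conjPeriodPair (hL : IsExpansionOfRealField L)
    (hP : WeierstrassPLocallyDefinable L univ (conjPeriodPair P)) :
    WeierstrassPLocallyDefinable L univ P := by
  have hU : IsOpen ((P.lattice : Set ℂ)ᶜ) := P.isClosed_lattice.isOpen_compl
  have h (z : ℂ) : P.weierstrassP z = (starRingEnd ℂ)
      ((conjPeriodPair P).weierstrassP ((starRingEnd ℂ) z)) := by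
    rw [weierstrassP_conjPeriodPair, Complex.conj_conj]
  rw [WeierstrassPLocallyDefinable, funext h]
  refine LocallyDefinableComplex.postcomp hL hU (LocallyDefinableComplex.precomp hL hU hP
    hL.definableComplexFun_conj Complex.continuous_conj fun z hz hz' => hz ?_)
    hL.definableComplexFun_conj
  simpa using mem_lattice_conjPeriodPair.mp hz'

end WeierstrassP

theorem mainTheorem11 (L : FirstOrder.Language.{u, v}) [L.Structure ℝ]
    (hL : IsExpansionOfRealField L) (A : Set ℝ) (P P' : PeriodPair)
    (hP : WeierstrassPLocallyDefinable L A P) (hPP' : ISREquivalent P P') :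
    WeierstrassPLocallyDefinable L Set.univ P' := by
  have hP : WeierstrassPLocallyDefinable L univ P :=
    ⟨hP.1.mono_parameters (subset_univ A), hP.2.mono_parameters (subset_univ A)⟩
  rcases hPP' with h | h
  · exact hP.of_isogenous hL h
  · exact (hP.of_isogenous hL h).of_conjPeriodPair hL
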